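/- Let $0<t<T$, $\sigma>0$, $S_0\in\mathbb R$, let $v$ be a fixed trading rate and $G$ a fixed decay kernel, integrable on $[0,T]$. Let $\Gamma\subseteq\mathbb R$ be a parameter set and $f(v;\cdot):\Gamma\to\mathbb R$ an impact function. Suppose that for each $\eta\in\Gamma$, under the probability measure $\mathbb P_\eta$, the price follows the propagator model $$S_r=S_0+\int_0^r f(v;\eta)\,G(r-s)\,ds+\sigma W_r,\qquad 0\le r\le T,$$ with $W$ a standard Brownian motion under $\mathbb P_\eta$. Let $\theta\in\Gamma$ be an accumulation point of $\Gamma$ at which $f(v;\cdot)$ is differentiable (relative to $\Gamma$). For a statistic $X$ with likelihood $p_\eta$ (the Lebesgue density of its law under $\mathbb P_\eta$), write $\mathcal I_X(\theta)=\mathbb E_\theta\big[\big(\tfrac{\partial}{\partial\theta}\log p_\theta(X)\big)^2\big]$ for its Fisher information, and let $J=\int_0^T S_r\,dr$. Then $\mathcal I_{S_t,S_T}(\theta)$ and $\mathcal I_J(\theta)$ exist, and $$\mathcal I_{S_t,S_T}(\theta)=\frac{\big(\frac{\partial f}{\partial\theta}(v;\theta)\big)^2}{\sigma^2}\left(\frac{\big(\int_0^tG(s)\,ds\big)^2}{t}+\frac{\big(\int_t^TG(s)\,ds\big)^2}{T-t}\right).$$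 Consequently $\mathcal I_{S_t,S_T}(\theta)\ge\mathcal I_J(\theta)$ whenever $$\frac{\big(\int_0^tG(s)\,ds\big)^2}{t}+\frac{\big(\int_t^TG(s)\,ds\big)^2}{T-t}\ \ge\ \frac{3}{T^3}\Big(\int_0^TG(s)(T-s)\,ds\Big)^2,$$ and if $\frac{\partial f}{\partial\theta}(v;\theta)\ne0$, the converse holds as well. -/

import Mathlib

open MeasureTheory ProbabilityTheory
open scoped NNReal

/-- `p η` is a density, with respect to Lebesgue measure, of the law of the statistic `X`
under `P η`, for every parameter `η ∈ Γ`. -/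
structure IsLikelihood {Ω E : Type*} [MeasurableSpace Ω] [MeasureSpace E]
    (Γ : Set ℝ) (P : ℝ → Measure Ω) (X : Ω → E) (p : ℝ → E → ℝ) : Prop where
  measurable : ∀ η ∈ Γ, Measurable (p η)
  nonneg : ∀ η ∈ Γ, ∀ x, 0 ≤ p η x
  hasLaw : ∀ η ∈ Γ,
    HasLaw X ((volume : Measure E).withDensity fun x => ENNReal.ofReal (p η x)) (P η)

/-- The score `∂ log p_θ(x) / ∂θ` (derivative relative to the parameter set `Γ`). -/
noncomputable def score {E : Type*} (Γ : Set ℝ) (p : ℝ → E → ℝ) (θ : ℝ) (x : E) : ℝ :=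
  derivWithin (fun η => Real.log (p η x)) Γ θ

/-- The experiment of observing the statistic `X` under `(P η)_{η ∈ Γ}` has a likelihood that is
almost surely differentiable in the parameter at `θ`, the score is square integrable under `P θ`,
and its second moment is `I`. -/
def HasFisherInfo {Ω E : Type*} [MeasurableSpace Ω] [MeasureSpace E]
    (Γ : Set ℝ) (P : ℝ → Measure Ω) (X : Ω → E) (θ : ℝ) (I : ℝ) : Prop :=
  ∃ p : ℝ → E → ℝ, IsLikelihood Γ P X p ∧
    (∀ᵐ ω ∂(P θ), DifferentiableWithinAt ℝ (fun η => p η (X ω)) Γ θ) ∧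
    Integrable (fun ω => score Γ p θ (X ω) ^ 2) (P θ) ∧
    ∫ ω, score Γ p θ (X ω) ^ 2 ∂(P θ) = I

open Classical in
/-- The Fisher information `E_θ[(∂ log p_θ(X) / ∂θ)²]` of the statistic `X` at `θ`
(`0` if it does not exist). By `HasFisherInfo.unique` it does not depend on the version of the
likelihood. -/
noncomputable def fisherInfo {Ω E : Type*} [MeasurableSpace Ω] [MeasureSpace E]
    (Γ : Set ℝ) (P : ℝ → Measure Ω) (X : Ω → E) (θ : ℝ) : ℝ :=
  if h : ∃ I, HasFisherInfo Γ P X θ I then h.choose else 0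

theorem HasFisherInfo.unique {Ω E : Type*} [MeasurableSpace Ω] [MeasureSpace E]
    [SigmaFinite (volume : Measure E)]
    {Γ : Set ℝ} {P : ℝ → Measure Ω} {X : Ω → E} {θ I I' : ℝ}
    (hθ : θ ∈ Γ) (hacc : AccPt θ (Filter.principal Γ))
    (h : HasFisherInfo Γ P X θ I) (h' : HasFisherInfo Γ P X θ I') : I = I' := by
  obtain ⟨p, hp, hpd, -, rfl⟩ := h
  obtain ⟨q, hq, hqd, -, rfl⟩ := h'
  have key : ∀ η ∈ Γ, ∀ᵐ ω ∂(P θ), p η (X ω) = q η (X ω) := by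
    intro η hη
    have e := (hp.hasLaw η hη).map_eq.symm.trans (hq.hasLaw η hη).map_eq
    have e2 := (withDensity_eq_iff_of_sigmaFinite
      ((hp.measurable η hη).ennreal_ofReal.aemeasurable)
      ((hq.measurable η hη).ennreal_ofReal.aemeasurable)).1 e
    have e3 : ∀ᵐ x ∂(volume : Measure E), p η x = q η x := by
      filter_upwards [e2] with x hx
      exact (ENNReal.ofReal_eq_ofReal_iff (hp.nonneg η hη x) (hq.nonneg η hη x)).1 hx
    have e4 : ∀ᵐ x ∂((P θ).map X), p η x = q η x := by
      rw [(hp.hasLaw θ hθ).map_eq]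
      exact (withDensity_absolutelyContinuous _ _).ae_le e3
    exact ae_of_ae_map (hp.hasLaw θ hθ).aemeasurable e4
  have hpos : ∀ᵐ ω ∂(P θ), p θ (X ω) ≠ 0 := by
    have e4 : ∀ᵐ x ∂((P θ).map X), p θ x ≠ 0 := by
      rw [(hp.hasLaw θ hθ).map_eq,
        ae_withDensity_iff (hp.measurable θ hθ).ennreal_ofReal]
      filter_upwards with x hx h0
      simp [h0] at hx
    exact ae_of_ae_map (hp.hasLaw θ hθ).aemeasurable e4
  have hu : UniqueDiffWithinAt ℝ Γ θ := uniqueDiffWithinAt_iff_accPt.2 hacc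
  rw [accPt_principal_iff_nhdsWithin] at hacc
  obtain ⟨u, hu1, hu2⟩ := mem_closure_iff_seq_limit.1
    (mem_closure_iff_nhdsWithin_neBot.2 hacc)
  have hut : Filter.Tendsto u Filter.atTop (nhdsWithin θ (Γ \ {θ})) :=
    tendsto_nhdsWithin_iff.2 ⟨hu2, Filter.Eventually.of_forall hu1⟩
  have hall : ∀ᵐ ω ∂(P θ), ∀ n, p (u n) (X ω) = q (u n) (X ω) :=
    ae_all_iff.2 fun n => key _ (hu1 n).1
  apply integral_congr_ae
  filter_upwards [hpd, hqd, hpos, key θ hθ, hall] with ω d1 d2 h0 e1 e2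
  have l1 := (d1.log h0).hasDerivWithinAt
  have l2 := (d2.log (e1 ▸ h0)).hasDerivWithinAt
  have t1 := (hasDerivWithinAt_iff_tendsto_slope.1 l1).comp hut
  have t2 := (hasDerivWithinAt_iff_tendsto_slope.1 l2).comp hut
  have : score Γ p θ (X ω) = score Γ q θ (X ω) := by
    refine tendsto_nhds_unique t1 (t2.congr fun n => ?_)
    simp [slope_def_field, e1, e2 n]
  simp only [this]

theorem HasFisherInfo.fisherInfo_eq {Ω E : Type*} [MeasurableSpace Ω] [MeasureSpace E]
    [SigmaFinite (volume : Measure E)]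
    {Γ : Set ℝ} {P : ℝ → Measure Ω} {X : Ω → E} {θ I : ℝ}
    (hθ : θ ∈ Γ) (hacc : AccPt θ (Filter.principal Γ))
    (h : HasFisherInfo Γ P X θ I) : fisherInfo Γ P X θ = I := by
  have h1 : ∃ I, HasFisherInfo Γ P X θ I := ⟨I, h⟩
  rw [fisherInfo, dif_pos h1]
  exact HasFisherInfo.unique hθ hacc h1.choose_spec h

/-- Under `P`, the process `S` follows, on `[0, T]`, the propagator dynamics
`S_t = S₀ + ∫₀ᵗ c G(t - s) ds + σ W_t` for a standard Brownian motion `W`, where `c` is the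
instantaneous impact of the constant trading rate. -/
def IsPropagatorPrice {Ω : Type*} [MeasurableSpace Ω] (P : Measure Ω)
    (S₀ c σ T : ℝ) (G : ℝ → ℝ) (S : ℝ → Ω → ℝ) : Prop :=
  ∃ W : ℝ≥0 → Ω → ℝ, IsBrownianReal W P ∧
    ∀ᵐ ω ∂P, ∀ t : ℝ≥0, (t : ℝ) ≤ T →
      S t ω = S₀ + (∫ s in (0 : ℝ)..t, c * G (t - s)) + σ * W t ω

/-- The pair of prices `(S_t, S_T)`. -/
def twoPrices {Ω : Type*} (S : ℝ → Ω → ℝ) (t T : ℝ) (ω : Ω) : ℝ × ℝ := (S t ω, S T ω)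

/-- The VWAP cost `J = ∫₀ᵀ S_r dr`. -/
noncomputable def vwapCost {Ω : Type*} (S : ℝ → Ω → ℝ) (T : ℝ) (ω : Ω) : ℝ :=
  ∫ r in (0 : ℝ)..T, S r ω

/-- The factor `(∫₀ᵗ G)² / t + (∫ₜᵀ G)² / (T - t)`. -/
noncomputable def twoPriceFactor (G : ℝ → ℝ) (t T : ℝ) : ℝ :=
  (∫ s in (0 : ℝ)..t, G s) ^ 2 / t + (∫ s in t..T, G s) ^ 2 / (T - t)

/-!
Since `W` has independent increments, `S_t` and `S_T - S_t` are independent Gaussian variables of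
variances `σ² t` and `σ² (T - t)`, and `(S_t, S_T)` is their image under the volume-preserving shear
`(x, y) ↦ (x, x + y)`, which leaves the Fisher information unchanged. Scores of independent
statistics add up and, being centred, so do their variances, which are the Fisher informations. The
time integral of `W` over `[0, T]` is an almost sure limit of centred Gaussian Riemann sums whose
variances converge to `T³ / 3`, hence is Gaussian with that variance; integrating the drift of `S`
by parts, `J` is Gaussian with mean `S₀ T + f(v; η) ∫₀ᵀ G(s) (T - s) ds` and variance `σ² T³ / 3`.
Everything thus reduces to a Gaussian location family with mean `m` and variance `w`, whose score is
`m'(θ) (x - m(θ)) / w` and whose information is `m'(θ)² / w`.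
-/

open Filter Set
open scoped ENNReal Topology

section RiemannSum

variable {E : Type*} [NormedAddCommGroup E] [NormedSpace ℝ E] [CompleteSpace E]
  {f : ℝ → E} {a b ε : ℝ}

theorem norm_smul_sub_intervalIntegral_le (hab : a ≤ b) (hf : IntervalIntegrable f volume a b)
    (hε : ∀ x ∈ Icc a b, ‖f a - f x‖ ≤ ε) :
    ‖(b - a) • f a - ∫ x in a..b, f x‖ ≤ (b - a) * ε := by
  rw [← intervalIntegral.integral_const,
    ← intervalIntegral.integral_sub intervalIntegrable_const hf, mul_comm,
    ← abs_of_nonneg (sub_nonneg.2 hab)]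
  refine intervalIntegral.norm_integral_le_of_norm_le_const fun x hx => hε x ?_
  exact Ioc_subset_Icc_self (uIoc_of_le hab ▸ hx)

theorem norm_riemannSum_sub_intervalIntegral_le {h : ℝ} (hh : 0 ≤ h) (n : ℕ)
    (hf : ContinuousOn f (Icc a (a + n * h)))
    (hε : ∀ x ∈ Icc a (a + n * h), ∀ y ∈ Icc a (a + n * h), dist x y ≤ h → ‖f x - f y‖ ≤ ε) :
    ‖h • ∑ k ∈ Finset.range n, f (a + k * h) - ∫ x in a..a + n * h, f x‖ ≤ n * h * ε := by
  induction n with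
  | zero => simp
  | succ n ih =>
    have hstep : a + (n + 1 : ℕ) * h - (a + n * h) = h := by push_cast; ring
    have hnh : 0 ≤ n * h := by positivity
    have hleft : Icc a (a + n * h) ⊆ Icc a (a + (n + 1 : ℕ) * h) :=
      Icc_subset_Icc_right (by linarith)
    have hright : Icc (a + n * h) (a + (n + 1 : ℕ) * h) ⊆ Icc a (a + (n + 1 : ℕ) * h) :=
      Icc_subset_Icc_left (by linarith)
    have hint_left : IntervalIntegrable f volume a (a + n * h) :=
      (hf.mono hleft).intervalIntegrable_of_Icc (by linarith)
    have hint_right : IntervalIntegrable f volume (a + n * h) (a + (n + 1 : ℕ) * h) :=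
      (hf.mono hright).intervalIntegrable_of_Icc (by linarith)
    have hlast : ‖h • f (a + n * h) - ∫ x in a + n * h..a + (n + 1 : ℕ) * h, f x‖ ≤ h * ε := by
      have hosc : ∀ x ∈ Icc (a + n * h) (a + (n + 1 : ℕ) * h), ‖f (a + n * h) - f x‖ ≤ ε := by
        intro x hx
        refine hε _ (hright (left_mem_Icc.2 (by linarith))) x (hright hx) ?_
        rw [dist_comm, Real.dist_eq, abs_of_nonneg (sub_nonneg.2 hx.1)]
        linarith [hx.2]
      simpa only [hstep] using norm_smul_sub_intervalIntegral_le (by linarith) hint_right hosc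
    rw [Finset.sum_range_succ, smul_add,
      ← intervalIntegral.integral_add_adjacent_intervals hint_left hint_right, add_sub_add_comm]
    calc _ ≤ n * h * ε + h * ε := norm_add_le_of_le
          (ih (hf.mono hleft) fun x hx y hy => hε x (hleft hx) y (hleft hy)) hlast
      _ = (n + 1 : ℕ) * h * ε := by push_cast; ring

theorem tendsto_riemannSum_intervalIntegral (hab : a ≤ b) (hf : ContinuousOn f (Icc a b)) :
    Tendsto (fun n : ℕ => ((b - a) / n) • ∑ k ∈ Finset.range n, f (a + k * ((b - a) / n))) atTop
      (𝓝 (∫ x in a..b, f x)) := by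
  rw [Metric.tendsto_atTop']
  intro ε hε
  have hlen : 0 ≤ b - a := sub_nonneg.2 hab
  obtain ⟨δ, hδ, hosc⟩ := Metric.uniformContinuousOn_iff.1
    (isCompact_Icc.uniformContinuousOn_of_continuous hf) (ε / (b - a + 1)) (by positivity)
  obtain ⟨N, hN⟩ := exists_nat_gt ((b - a) / δ)
  refine ⟨N, fun n hn => ?_⟩
  have hn0 : (0 : ℝ) < n := by exact_mod_cast (Nat.zero_le N).trans_lt hn
  have hmesh : (b - a) / n < δ := by
    rw [div_lt_comm₀ hn0 hδ]
    exact hN.trans (by exact_mod_cast hn)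
  have hend : a + n * ((b - a) / n) = b := by field_simp; ring
  have hsum := norm_riemannSum_sub_intervalIntegral_le (f := f) (a := a) (h := (b - a) / n)
    (ε := ε / (b - a + 1)) (by positivity) n
  rw [hend] at hsum
  rw [dist_eq_norm]
  calc _ ≤ n * ((b - a) / n) * (ε / (b - a + 1)) := hsum hf fun x hx y hy hxy =>
        (dist_eq_norm (f x) (f y) ▸ hosc x hx y hy (hxy.trans_lt hmesh)).le
    _ = ε * ((b - a) / (b - a + 1)) := by field_simp
    _ < ε := mul_lt_of_lt_one_right hε ((div_lt_one (by positivity)).2 (lt_add_one _))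

end RiemannSum

section Gaussian

variable {Ω : Type*} [MeasurableSpace Ω] {P : Measure Ω}

theorem hasLaw_gaussianReal_of_eq_add_mul {X Y : Ω → ℝ} {v : ℝ≥0}
    (hX : HasLaw X (gaussianReal 0 v) P) (a b : ℝ) (hY : ∀ᵐ ω ∂P, Y ω = a + b * X ω) :
    HasLaw Y (gaussianReal a (.mk (b ^ 2) (sq_nonneg b) * v)) P := by
  have hlaw := gaussianReal_const_add (gaussianReal_const_mul hX b) a
  rw [mul_zero, zero_add] at hlaw
  exact hlaw.congr hY

theorem hasLaw_gaussianReal_of_tendsto_ae {X : ℕ → Ω → ℝ} {Y : Ω → ℝ} {m : ℕ → ℝ} {v : ℕ → ℝ≥0}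
    {m' : ℝ} {v' : ℝ≥0} (hX : ∀ n, HasLaw (X n) (gaussianReal (m n) (v n)) P)
    (hXY : ∀ᵐ ω ∂P, Tendsto (fun n => X n ω) atTop (𝓝 (Y ω)))
    (hm : Tendsto m atTop (𝓝 m')) (hv : Tendsto v atTop (𝓝 v')) :
    HasLaw Y (gaussianReal m' v') P := by
  have hP : IsProbabilityMeasure P := (hX 0).isProbabilityMeasure
  have hXmeas : ∀ n, AEMeasurable (X n) P := fun n => (hX n).aemeasurable
  have hY : AEMeasurable Y P := aemeasurable_of_tendsto_metrizable_ae _ hXmeas hXY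
  have : IsProbabilityMeasure (P.map Y) := Measure.isProbabilityMeasure_map hY
  refine ⟨hY, Measure.ext_of_charFun (funext fun u => ?_)⟩
  have hlim_law : Tendsto (fun n => charFun (P.map (X n)) u) atTop (𝓝 (charFun (P.map Y) u)) :=
    ProbabilityMeasure.tendsto_iff_tendsto_charFun.1
      (tendstoInDistribution_of_ae_tendsto hXmeas hY hXY).tendsto u
  have hcont : Continuous fun q : ℝ × ℝ≥0 => charFun (gaussianReal q.1 q.2) u := by
    simp only [charFun_gaussianReal]
    fun_prop
  have hlim_gaussian := (hcont.tendsto (m', v')).comp (hm.prodMk_nhds hv)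
  refine tendsto_nhds_unique hlim_law (hlim_gaussian.congr fun n => ?_)
  simp only [Function.comp_apply, (hX n).map_eq]

end Gaussian

section BrownianIntegral

variable {Ω : Type*} [MeasurableSpace Ω] {P : Measure Ω} {B : ℝ≥0 → Ω → ℝ}

theorem sum_sum_min_range (n : ℕ) :
    ∑ i ∈ Finset.range n, ∑ j ∈ Finset.range n, min i j = ∑ k ∈ Finset.range n, k ^ 2 := by
  induction n with
  | zero => rfl
  | succ n ih =>
    have hrow : ∑ i ∈ Finset.range n, min i n = ∑ i ∈ Finset.range n, i :=
      Finset.sum_congr rfl fun i hi => min_eq_left (Finset.mem_range.1 hi).le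
    have hcol : ∑ j ∈ Finset.range n, min n j = ∑ j ∈ Finset.range n, j :=
      Finset.sum_congr rfl fun j hj => min_eq_right (Finset.mem_range.1 hj).le
    have hgauss : (∑ i ∈ Finset.range n, i) * 2 + n = n ^ 2 := by
      cases n with
      | zero => rfl
      | succ n => rw [Finset.sum_range_id_mul_two, add_tsub_cancel_right]; ring
    simp only [Finset.sum_range_succ, Finset.sum_add_distrib, ih, hrow, hcol, min_self, ← hgauss]
    ring

theorem variance_riemannSum_brownian (hB : IsPreBrownianReal B P) (h : ℝ≥0) (n : ℕ) :
    Var[fun ω => h * ∑ k ∈ Finset.range n, B (k * h) ω; P]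
      = h * ∑ k ∈ Finset.range n, ((k : ℝ) * h) ^ 2 := by
  have hL2 : ∀ r, MemLp (B r) 2 P :=
    fun r => (hB.isGaussianProcess.hasGaussianLaw_eval r).memLp_two
  have hcov : ∀ i j : ℕ, cov[B (i * h), B (j * h); P] = h * (min i j : ℕ) := by
    intro i j
    rw [hB.covariance_eval, ← min_mul_of_nonneg _ _ (zero_le (a := h)), ← Nat.cast_min,
      NNReal.coe_mul, mul_comm, NNReal.coe_natCast]
  have hP := hB.isGaussianProcess.isProbabilityMeasure
  rw [variance_const_mul, variance_fun_sum' fun k _ => hL2 _]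
  simp only [hcov, ← Finset.mul_sum, ← Nat.cast_sum, sum_sum_min_range]
  simp only [Nat.cast_sum, Nat.cast_pow, mul_pow, ← Finset.sum_mul]
  ring

theorem hasLaw_riemannSum_brownian (hB : IsPreBrownianReal B P) (h : ℝ≥0) (n : ℕ) :
    HasLaw (fun ω => h * ∑ k ∈ Finset.range n, B (k * h) ω)
      (gaussianReal 0 (h * ∑ k ∈ Finset.range n, (k * h) ^ 2)) P := by
  have hgaussian : HasGaussianLaw (fun ω => h * ∑ k ∈ Finset.range n, B (k * h) ω) P :=
    ((hB.isGaussianProcess.comp_right fun k : ℕ => k * h).hasGaussianLaw_fun_sum).fun_smul (h : ℝ)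
  have hmean : ∫ ω, h * ∑ k ∈ Finset.range n, B (k * h) ω ∂P = 0 := by
    rw [integral_const_mul, integral_finsetSum _ fun k _ => hB.integrable_eval _]
    simp only [hB.integral_eval, Finset.sum_const_zero, mul_zero]
  refine ⟨hgaussian.aemeasurable, ?_⟩
  rw [hgaussian.map_eq_gaussianReal, hmean, variance_riemannSum_brownian hB]
  congr 1
  exact NNReal.eq ((Real.coe_toNNReal _ (by positivity)).trans (by push_cast; rfl))

theorem hasLaw_intervalIntegral_brownian (hB : IsBrownianReal B P) (T : ℝ≥0) :
    HasLaw (fun ω => ∫ r in (0 : ℝ)..T, B r.toNNReal ω) (gaussianReal 0 (T ^ 3 / 3)) P := by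
  refine hasLaw_gaussianReal_of_tendsto_ae
    (fun n => hasLaw_riemannSum_brownian hB.toIsPreBrownianReal (T / n) n) ?_ tendsto_const_nhds ?_
  · filter_upwards [hB.cont] with ω hω
    have hcont : Continuous fun r : ℝ => B r.toNNReal ω := hω.comp continuous_real_toNNReal
    simpa [Real.toNNReal_mul, Real.toNNReal_div] using
      tendsto_riemannSum_intervalIntegral T.2 hcont.continuousOn
  · -- The variances are themselves Riemann sums, of `r ↦ r ^ 2` over `[0, T]`.
    have hsq : Continuous fun r : ℝ => r ^ 2 := by fun_prop
    have hlim := tendsto_riemannSum_intervalIntegral T.2 hsq.continuousOn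
    rw [← NNReal.tendsto_coe]
    convert hlim using 2
    · simp
    · norm_num [integral_pow]

end BrownianIntegral

theorem measurePreserving_withDensity_comp {α β : Type*} [MeasurableSpace α] [MeasurableSpace β]
    {μ : Measure α} {ν : Measure β} {e : α → β} {g : β → ℝ≥0∞} (he : MeasurePreserving e μ ν)
    (hg : Measurable g) :
    MeasurePreserving e (μ.withDensity fun x => g (e x)) (ν.withDensity g) := by
  refine ⟨he.measurable, Measure.ext fun s hs => ?_⟩
  rw [Measure.map_apply he.measurable hs, withDensity_apply _ (he.measurable hs),
    withDensity_apply _ hs, he.setLIntegral_comp_preimage hs hg]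

theorem score_mul {E F : Type*} {Γ : Set ℝ} {p : ℝ → E → ℝ} {q : ℝ → F → ℝ} {θ : ℝ} {x : E} {y : F}
    (hθ : UniqueDiffWithinAt ℝ Γ θ)
    (hp : DifferentiableWithinAt ℝ (fun η => p η x) Γ θ) (hpx : p θ x ≠ 0)
    (hq : DifferentiableWithinAt ℝ (fun η => q η y) Γ θ) (hqy : q θ y ≠ 0) :
    score Γ (fun η (z : E × F) => p η z.1 * q η z.2) θ (x, y) = score Γ p θ x + score Γ q θ y := by
  simp only [score]
  rw [derivWithin.log (hp.fun_mul hq) (mul_ne_zero hpx hqy) hθ, derivWithin.log hp hpx hθ,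
    derivWithin.log hq hqy hθ, derivWithin_fun_mul hp hq]
  field_simp

section FisherInformation

variable {Ω E F : Type*} [MeasurableSpace Ω] [MeasureSpace E] [MeasureSpace F]
  {Γ : Set ℝ} {P : ℝ → Measure Ω} {X : Ω → E} {Y : Ω → F} {p : ℝ → E → ℝ} {q : ℝ → F → ℝ} {θ I : ℝ}

theorem IsLikelihood.comp_measurableEquiv (h : IsLikelihood Γ P X p) (e : E ≃ᵐ F)
    (he : MeasurePreserving e) : IsLikelihood Γ P (e ∘ X) fun η y => p η (e.symm y) where
  measurable η hη := (h.measurable η hη).comp e.symm.measurable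
  nonneg η hη y := h.nonneg η hη _
  hasLaw η hη := by
    have hpush := measurePreserving_withDensity_comp he
      ((h.measurable η hη).comp e.symm.measurable).ennreal_ofReal
    simp only [Function.comp_apply, e.symm_apply_apply] at hpush
    exact hpush.hasLaw.comp (h.hasLaw η hη)

theorem HasFisherInfo.comp_measurableEquiv (h : HasFisherInfo Γ P X θ I) (e : E ≃ᵐ F)
    (he : MeasurePreserving e) : HasFisherInfo Γ P (e ∘ X) θ I := by
  obtain ⟨p, hp, hdiff, hint, hI⟩ := h
  refine ⟨fun η y => p η (e.symm y), hp.comp_measurableEquiv e he, ?_⟩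
  simp only [score, Function.comp_apply, e.symm_apply_apply]
  exact ⟨hdiff, hint, hI⟩

theorem IsLikelihood.ae_ne_zero (h : IsLikelihood Γ P X p) (hθ : θ ∈ Γ) :
    ∀ᵐ x ∂(P θ).map X, p θ x ≠ 0 := by
  rw [(h.hasLaw θ hθ).map_eq, ae_withDensity_iff (h.measurable θ hθ).ennreal_ofReal]
  exact .of_forall fun x hx h0 => hx (by rw [h0, ENNReal.ofReal_zero])

theorem IsLikelihood.prodMk [SFinite (volume : Measure E)] [SFinite (volume : Measure F)]
    (hX : IsLikelihood Γ P X p) (hY : IsLikelihood Γ P Y q)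
    (hP : ∀ η ∈ Γ, IsFiniteMeasure (P η)) (hXY : ∀ η ∈ Γ, IndepFun X Y (P η)) :
    IsLikelihood Γ P (fun ω => (X ω, Y ω)) fun η z => p η z.1 * q η z.2 where
  measurable η hη :=
    ((hX.measurable η hη).comp measurable_fst).mul ((hY.measurable η hη).comp measurable_snd)
  nonneg η hη z := mul_nonneg (hX.nonneg η hη z.1) (hY.nonneg η hη z.2)
  hasLaw η hη := by
    have hPη := hP η hη
    have hprod := (hXY η hη).hasLaw_prod (hX.hasLaw η hη) (hY.hasLaw η hη)
    rw [prod_withDensity (hX.measurable η hη).ennreal_ofReal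
      (hY.measurable η hη).ennreal_ofReal] at hprod
    simp only [ENNReal.ofReal_mul (hX.nonneg η hη _)]
    exact hprod

/-- A likelihood obeying the classical regularity conditions at `θ`: it is almost surely
differentiable in the parameter, and its score is square integrable and centred. Centring does not
follow from the other conditions and is what makes the Fisher informations of independent statistics
add up. The conditions are imposed under the law of `X`, so that the score is almost everywhere
measurable as a function of the observation. -/
structure IsRegularLikelihood (Γ : Set ℝ) (P : ℝ → Measure Ω) (X : Ω → E) (θ : ℝ)
    (p : ℝ → E → ℝ) : Prop extends IsLikelihood Γ P X p where
  ae_differentiableWithinAt : ∀ᵐ x ∂(P θ).map X, DifferentiableWithinAt ℝ (fun η => p η x) Γ θ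
  memLp_score : MemLp (score Γ p θ) 2 ((P θ).map X)
  integral_score : ∫ x, score Γ p θ x ∂(P θ).map X = 0

namespace IsRegularLikelihood

theorem hasFisherInfo (h : IsRegularLikelihood Γ P X θ p) (hθ : θ ∈ Γ) :
    HasFisherInfo Γ P X θ Var[score Γ p θ; (P θ).map X] := by
  have hX : AEMeasurable X (P θ) := (h.hasLaw θ hθ).aemeasurable
  have hmeas := h.memLp_score.aestronglyMeasurable
  refine ⟨p, h.toIsLikelihood, ae_of_ae_map hX h.ae_differentiableWithinAt,
    (h.memLp_score.comp_of_map hX).integrable_sq, ?_⟩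
  rw [variance_of_integral_eq_zero hmeas.aemeasurable h.integral_score]
  exact (integral_map hX (hmeas.pow 2)).symm

theorem score_prodMk_ae_eq [SFinite (P θ)] (hX : IsRegularLikelihood Γ P X θ p)
    (hY : IsRegularLikelihood Γ P Y θ q) (hθ : θ ∈ Γ) (hacc : AccPt θ (𝓟 Γ)) :
    score Γ (fun η (z : E × F) => p η z.1 * q η z.2) θ
      =ᵐ[((P θ).map X).prod ((P θ).map Y)] fun z => score Γ p θ z.1 + score Γ q θ z.2 := by
  filter_upwards [Measure.quasiMeasurePreserving_fst.ae hX.ae_differentiableWithinAt,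
    Measure.quasiMeasurePreserving_fst.ae (hX.ae_ne_zero hθ),
    Measure.quasiMeasurePreserving_snd.ae hY.ae_differentiableWithinAt,
    Measure.quasiMeasurePreserving_snd.ae (hY.ae_ne_zero hθ)] with z hpz hpz0 hqz hqz0
  exact score_mul (uniqueDiffWithinAt_iff_accPt.2 hacc) hpz hpz0 hqz hqz0

variable [SFinite (volume : Measure E)] [SFinite (volume : Measure F)]

theorem prodMk (hX : IsRegularLikelihood Γ P X θ p) (hY : IsRegularLikelihood Γ P Y θ q)
    (hP : ∀ η ∈ Γ, IsFiniteMeasure (P η)) (hXY : ∀ η ∈ Γ, IndepFun X Y (P η))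
    (hθ : θ ∈ Γ) (hacc : AccPt θ (𝓟 Γ)) :
    IsRegularLikelihood Γ P (fun ω => (X ω, Y ω)) θ fun η z => p η z.1 * q η z.2 := by
  have hPθ := hP θ hθ
  have hlaw : (P θ).map (fun ω => (X ω, Y ω)) = ((P θ).map X).prod ((P θ).map Y) :=
    (hXY θ hθ).map_prod_eq_prod_map_map (hX.hasLaw θ hθ).aemeasurable (hY.hasLaw θ hθ).aemeasurable
  have hscore := hX.score_prodMk_ae_eq hY hθ hacc
  have hLX := hX.memLp_score.comp_fst ((P θ).map Y)
  have hLY := hY.memLp_score.comp_snd ((P θ).map X)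
  refine ⟨hX.toIsLikelihood.prodMk hY.toIsLikelihood hP hXY, ?_, ?_, ?_⟩ <;> rw [hlaw]
  · filter_upwards [Measure.quasiMeasurePreserving_fst.ae hX.ae_differentiableWithinAt,
      Measure.quasiMeasurePreserving_snd.ae hY.ae_differentiableWithinAt] with z hpz hqz
    exact hpz.fun_mul hqz
  · exact (hLX.add hLY).ae_eq hscore.symm
  · rw [integral_congr_ae hscore,
      integral_add (hLX.integrable one_le_two) (hLY.integrable one_le_two), integral_fun_fst,
      integral_fun_snd, hX.integral_score, hY.integral_score, smul_zero, smul_zero, add_zero]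

theorem hasFisherInfo_prodMk (hX : IsRegularLikelihood Γ P X θ p)
    (hY : IsRegularLikelihood Γ P Y θ q) (hP : ∀ η ∈ Γ, IsProbabilityMeasure (P η))
    (hXY : ∀ η ∈ Γ, IndepFun X Y (P η)) (hθ : θ ∈ Γ) (hacc : AccPt θ (𝓟 Γ)) :
    HasFisherInfo Γ P (fun ω => (X ω, Y ω)) θ
      (Var[score Γ p θ; (P θ).map X] + Var[score Γ q θ; (P θ).map Y]) := by
  have hPθ := hP θ hθ
  have hXmeas := (hX.hasLaw θ hθ).aemeasurable
  have hYmeas := (hY.hasLaw θ hθ).aemeasurable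
  have hPX := Measure.isProbabilityMeasure_map hXmeas
  have hPY := Measure.isProbabilityMeasure_map hYmeas
  have hPfin : ∀ η ∈ Γ, IsFiniteMeasure (P η) := fun η hη => have := hP η hη; inferInstance
  have hinfo := (hX.prodMk hY hPfin hXY hθ hacc).hasFisherInfo hθ
  rwa [(hXY θ hθ).map_prod_eq_prod_map_map hXmeas hYmeas,
    variance_congr (hX.score_prodMk_ae_eq hY hθ hacc),
    variance_add_prod hX.memLp_score hY.memLp_score] at hinfo

end IsRegularLikelihood

end FisherInformation

section GaussianLocation

variable {Ω : Type*} [MeasurableSpace Ω] {Γ : Set ℝ} {P : ℝ → Measure Ω} {X : Ω → ℝ}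
  {m : ℝ → ℝ} {m' θ : ℝ} {v : ℝ≥0}

theorem hasDerivWithinAt_log_gaussianPDFReal (hv : v ≠ 0) (hm : HasDerivWithinAt m m' Γ θ) (x : ℝ) :
    HasDerivWithinAt (fun η => Real.log (gaussianPDFReal (m η) v x)) (m' / v * (x - m θ)) Γ θ := by
  have hlog : ∀ η, Real.log (gaussianPDFReal (m η) v x)
      = Real.log (√(2 * Real.pi * v))⁻¹ + -(x - m η) ^ 2 / (2 * v) := by
    intro η
    have : (0 : ℝ) < v := by positivity
    rw [gaussianPDFReal, Real.log_mul (by positivity) (Real.exp_pos _).ne', Real.log_exp]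
  simp only [hlog]
  refine ((((hm.const_sub x).fun_pow 2).fun_neg.div_const (2 * (v : ℝ))).const_add _).congr_deriv ?_
  push_cast
  ring

theorem score_gaussianPDFReal (hv : v ≠ 0) (hm : HasDerivWithinAt m m' Γ θ)
    (hacc : AccPt θ (𝓟 Γ)) :
    score Γ (fun η => gaussianPDFReal (m η) v) θ = fun x => m' / v * (x - m θ) :=
  funext fun x => (hasDerivWithinAt_log_gaussianPDFReal hv hm x).derivWithin
    (uniqueDiffWithinAt_iff_accPt.2 hacc)

theorem isRegularLikelihood_gaussianPDFReal (hv : v ≠ 0)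
    (hX : ∀ η ∈ Γ, HasLaw X (gaussianReal (m η) v) (P η)) (hm : HasDerivWithinAt m m' Γ θ)
    (hθ : θ ∈ Γ) (hacc : AccPt θ (𝓟 Γ)) :
    IsRegularLikelihood Γ P X θ fun η => gaussianPDFReal (m η) v where
  measurable η _ := measurable_gaussianPDFReal _ _
  nonneg η _ := gaussianPDFReal_nonneg _ _
  hasLaw η hη := gaussianReal_of_var_ne_zero (m η) hv ▸ hX η hη
  ae_differentiableWithinAt := by
    have hmdiff := hm.differentiableWithinAt
    refine .of_forall fun x => ?_
    simp only [gaussianPDFReal]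
    fun_prop
  memLp_score := by
    rw [score_gaussianPDFReal hv hm hacc, (hX θ hθ).map_eq]
    exact ((memLp_id_gaussianReal 2).sub (memLp_const (m θ))).const_mul _
  integral_score := by
    have hint : Integrable (fun x => x) (gaussianReal (m θ) v) :=
      (memLp_id_gaussianReal 1).integrable le_rfl
    rw [score_gaussianPDFReal hv hm hacc, (hX θ hθ).map_eq, integral_const_mul,
      integral_sub hint (integrable_const _), integral_id_gaussianReal]
    simp

theorem variance_score_gaussianPDFReal (hv : v ≠ 0) (hm : HasDerivWithinAt m m' Γ θ)
    (hacc : AccPt θ (𝓟 Γ)) :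
    Var[score Γ (fun η => gaussianPDFReal (m η) v) θ; gaussianReal (m θ) v] = m' ^ 2 / v := by
  rw [score_gaussianPDFReal hv hm hacc, variance_const_mul,
    variance_sub_const (X := fun x => x) (by fun_prop), variance_fun_id_gaussianReal]
  field_simp

end GaussianLocation

theorem integral_primitive_eq_integral_mul_sub {G : ℝ → ℝ} {a b : ℝ}
    (hG : IntervalIntegrable G volume a b) :
    ∫ r in a..b, ∫ s in a..r, G s = ∫ s in a..b, G s * (b - s) := by
  have hprimitive := hG.absolutelyContinuousOnInterval_intervalIntegral left_mem_uIcc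
  have hweight : AbsolutelyContinuousOnInterval (fun r : ℝ => r - b) a b :=
    ContDiffOn.absolutelyContinuousOnInterval (by fun_prop)
  have hderiv : ∫ r in a..b, deriv (fun r => ∫ s in a..r, G s) r * (r - b)
      = ∫ r in a..b, G r * (r - b) := by
    refine intervalIntegral.integral_congr_ae ?_
    filter_upwards [hG.ae_hasDerivAt_integral] with r hr hrab
    rw [(hr (uIoc_subset_uIcc hrab) a left_mem_uIcc).deriv]
  have hparts := hprimitive.integral_mul_deriv_eq_deriv_mul hweight
  simp only [deriv_sub_const_fun, deriv_id'', mul_one, sub_self, mul_zero, zero_mul, zero_sub,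
    intervalIntegral.integral_same, hderiv, ← intervalIntegral.integral_neg] at hparts
  rw [hparts]
  exact intervalIntegral.integral_congr fun r _ => by ring

namespace IsPropagatorPrice

variable {Ω : Type*} [MeasurableSpace Ω] {P : Measure Ω} {S₀ c σ : ℝ} {T s t : ℝ≥0} {G : ℝ → ℝ}
  {S : ℝ → Ω → ℝ}

theorem exists_isBrownianReal (hS : IsPropagatorPrice P S₀ c σ T G S) :
    ∃ W : ℝ≥0 → Ω → ℝ, IsBrownianReal W P ∧ ∀ᵐ ω ∂P, ∀ r : ℝ≥0, r ≤ T →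
      S r ω = S₀ + c * (∫ s in (0 : ℝ)..r, G s) + σ * W r ω := by
  obtain ⟨W, hW, hdyn⟩ := hS
  refine ⟨W, hW, hdyn.mono fun ω hω r hr => ?_⟩
  rw [hω r (by exact_mod_cast hr), intervalIntegral.integral_const_mul,
    intervalIntegral.integral_comp_sub_left, sub_self, sub_zero]

theorem hasLaw_eval (hS : IsPropagatorPrice P S₀ c σ T G S) (ht : t ≤ T) :
    HasLaw (S t) (gaussianReal (S₀ + c * ∫ s in (0 : ℝ)..t, G s)
      (.mk (σ ^ 2) (sq_nonneg σ) * t)) P := by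
  obtain ⟨W, hW, hdyn⟩ := hS.exists_isBrownianReal
  exact hasLaw_gaussianReal_of_eq_add_mul (hW.hasLaw_eval t) _ σ (hdyn.mono fun ω hω => hω t ht)

theorem hasLaw_sub (hS : IsPropagatorPrice P S₀ c σ T G S) (hG : IntervalIntegrable G volume 0 T)
    (hst : s ≤ t) (ht : t ≤ T) :
    HasLaw (S t - S s) (gaussianReal (c * ∫ r in (s : ℝ)..t, G r)
      (.mk (σ ^ 2) (sq_nonneg σ) * (t - s))) P := by
  obtain ⟨W, hW, hdyn⟩ := hS.exists_isBrownianReal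
  have hlaw : HasLaw (W t - W s) (gaussianReal 0 (t - s)) P := by
    have hdist : nndist t s = t - s := by
      rw [NNReal.nndist_eq, tsub_eq_zero_of_le hst, max_eq_left zero_le]
    exact hdist ▸ hW.hasLaw_sub t s
  have hGint : ∀ r : ℝ≥0, r ≤ T → IntervalIntegrable G volume 0 r := fun r hr =>
    hG.mono_set (uIcc_subset_uIcc_left (mem_uIcc_of_le r.2 (by exact_mod_cast hr)))
  refine hasLaw_gaussianReal_of_eq_add_mul hlaw _ σ (hdyn.mono fun ω hω => ?_)
  rw [Pi.sub_apply, Pi.sub_apply, hω t ht, hω s (hst.trans ht),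
    ← intervalIntegral.integral_interval_sub_left (hGint t ht) (hGint s (hst.trans ht))]
  ring

theorem indepFun_eval_sub (hS : IsPropagatorPrice P S₀ c σ T G S) (hst : s ≤ t) (ht : t ≤ T) :
    IndepFun (S s) (S t - S s) P := by
  obtain ⟨W, hW, hdyn⟩ := hS.exists_isBrownianReal
  have hindep : IndepFun (W s) (W t - W s) P :=
    hW.hasIndepIncrements.indepFun_eval_sub zero_le hst hW.eval_zero_ae_eq_zero
  set F : ℝ≥0 → ℝ := fun r => c * ∫ u in (0 : ℝ)..r, G u
  refine (hindep.comp (φ := fun x => S₀ + F s + σ * x) (ψ := fun x => F t - F s + σ * x)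
    (by fun_prop) (by fun_prop)).congr ?_ ?_
  · exact hdyn.mono fun ω hω => (hω s (hst.trans ht)).symm
  · refine hdyn.mono fun ω hω => ?_
    simp only [Function.comp_apply, Pi.sub_apply, hω t ht, hω s (hst.trans ht), F]
    ring

theorem exists_vwapCost_eq (hS : IsPropagatorPrice P S₀ c σ T G S)
    (hG : IntervalIntegrable G volume 0 T) :
    ∃ W : ℝ≥0 → Ω → ℝ, IsBrownianReal W P ∧ ∀ᵐ ω ∂P,
      vwapCost S T ω = S₀ * T + c * (∫ s in (0 : ℝ)..T, G s * (T - s))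
        + σ * ∫ r in (0 : ℝ)..T, W r.toNNReal ω := by
  obtain ⟨W, hW, hdyn⟩ := hS.exists_isBrownianReal
  refine ⟨W, hW, ?_⟩
  filter_upwards [hdyn, hW.cont] with ω hω hcont
  have hWint : IntervalIntegrable (fun r : ℝ => σ * W r.toNNReal ω) volume 0 T :=
    ((hcont.comp continuous_real_toNNReal).const_mul σ).intervalIntegrable _ _
  have hGint : IntervalIntegrable (fun r => c * ∫ s in (0 : ℝ)..r, G s) volume 0 T :=
    ((intervalIntegral.continuousOn_primitive_interval' hG
      left_mem_uIcc).const_mul c).intervalIntegrable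
  have hprice : EqOn (fun r => S r ω)
      (fun r => S₀ + c * (∫ s in (0 : ℝ)..r, G s) + σ * W r.toNNReal ω) (uIcc 0 T) := by
    intro r hr
    rw [uIcc_of_le T.coe_nonneg] at hr
    simpa only [Real.coe_toNNReal r hr.1] using hω r.toNNReal (Real.toNNReal_le_iff_le_coe.2 hr.2)
  rw [vwapCost, intervalIntegral.integral_congr hprice,
    intervalIntegral.integral_add (intervalIntegrable_const.add hGint) hWint,
    intervalIntegral.integral_add intervalIntegrable_const hGint, intervalIntegral.integral_const,
    intervalIntegral.integral_const_mul, intervalIntegral.integral_const_mul,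
    integral_primitive_eq_integral_mul_sub hG, sub_zero, smul_eq_mul, mul_comm S₀]

theorem hasLaw_vwapCost (hS : IsPropagatorPrice P S₀ c σ T G S)
    (hG : IntervalIntegrable G volume 0 T) :
    HasLaw (vwapCost S T) (gaussianReal (S₀ * T + c * ∫ s in (0 : ℝ)..T, G s * (T - s))
      (.mk (σ ^ 2) (sq_nonneg σ) * (T ^ 3 / 3))) P := by
  obtain ⟨W, hW, hJ⟩ := hS.exists_vwapCost_eq hG
  exact hasLaw_gaussianReal_of_eq_add_mul (hasLaw_intervalIntegral_brownian hW T) _ σ hJ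

end IsPropagatorPrice

section PropagatorFamily

variable {Ω : Type*} [MeasurableSpace Ω] {Γ : Set ℝ} {P : ℝ → Measure Ω} {S : ℝ → Ω → ℝ}
  {g G : ℝ → ℝ} {g' S₀ σ θ : ℝ}

theorem hasFisherInfo_twoPrices {t T : ℝ≥0} (hσ : σ ≠ 0) (ht : 0 < t) (htT : t < T)
    (hG : IntervalIntegrable G volume 0 T)
    (hS : ∀ η ∈ Γ, IsPropagatorPrice (P η) S₀ (g η) σ T G S)
    (hθ : θ ∈ Γ) (hacc : AccPt θ (𝓟 Γ)) (hg : HasDerivWithinAt g g' Γ θ) :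
    HasFisherInfo Γ P (twoPrices S t T) θ (g' ^ 2 / σ ^ 2 * twoPriceFactor G t T) := by
  have hσ2 : NNReal.mk (σ ^ 2) (sq_nonneg σ) ≠ 0 :=
    NNReal.coe_ne_zero.1 (pow_ne_zero 2 hσ)
  have hvar_early : NNReal.mk (σ ^ 2) (sq_nonneg σ) * t ≠ 0 := mul_ne_zero hσ2 ht.ne'
  have hvar_late : NNReal.mk (σ ^ 2) (sq_nonneg σ) * (T - t) ≠ 0 :=
    mul_ne_zero hσ2 (tsub_pos_of_lt htT).ne'
  have hlaw_early := fun η hη => (hS η hη).hasLaw_eval htT.le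
  have hlaw_late := fun η hη => (hS η hη).hasLaw_sub hG htT.le le_rfl
  have hmean_early := (hg.mul_const (∫ s in (0 : ℝ)..t, G s)).const_add S₀
  have hmean_late := hg.mul_const (∫ s in (t : ℝ)..T, G s)
  have hincrements := (isRegularLikelihood_gaussianPDFReal hvar_early hlaw_early hmean_early hθ
    hacc).hasFisherInfo_prodMk
      (isRegularLikelihood_gaussianPDFReal hvar_late hlaw_late hmean_late hθ hacc)
      (fun η hη => (hlaw_early η hη).isProbabilityMeasure)
      (fun η hη => (hS η hη).indepFun_eval_sub htT.le le_rfl) hθ hacc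
  rw [(hlaw_early θ hθ).map_eq, (hlaw_late θ hθ).map_eq,
    variance_score_gaussianPDFReal hvar_early hmean_early hacc,
    variance_score_gaussianPDFReal hvar_late hmean_late hacc] at hincrements
  have hshear := hincrements.comp_measurableEquiv (.shearAddRight ℝ)
    (measurePreserving_prod_add volume volume)
  convert hshear using 1
  · funext ω
    simp [twoPrices, MeasurableEquiv.shearAddRight]
  · rw [twoPriceFactor, NNReal.coe_mul, NNReal.coe_mul, NNReal.coe_sub htT.le, NNReal.coe_mk]
    field_simp

theorem hasFisherInfo_vwapCost {T : ℝ≥0} (hσ : σ ≠ 0) (hT : 0 < T)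
    (hG : IntervalIntegrable G volume 0 T)
    (hS : ∀ η ∈ Γ, IsPropagatorPrice (P η) S₀ (g η) σ T G S)
    (hθ : θ ∈ Γ) (hacc : AccPt θ (𝓟 Γ)) (hg : HasDerivWithinAt g g' Γ θ) :
    HasFisherInfo Γ P (vwapCost S T) θ
      (g' ^ 2 / σ ^ 2 * (3 / T ^ 3 * (∫ s in (0 : ℝ)..T, G s * (T - s)) ^ 2)) := by
  have hσ2 : NNReal.mk (σ ^ 2) (sq_nonneg σ) ≠ 0 :=
    NNReal.coe_ne_zero.1 (pow_ne_zero 2 hσ)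
  have hvar : NNReal.mk (σ ^ 2) (sq_nonneg σ) * (T ^ 3 / 3) ≠ 0 :=
    mul_ne_zero hσ2 (by positivity)
  have hlaw := fun η hη => (hS η hη).hasLaw_vwapCost hG
  have hmean := (hg.mul_const (∫ s in (0 : ℝ)..T, G s * (T - s))).const_add (S₀ * T)
  have hinfo := (isRegularLikelihood_gaussianPDFReal hvar hlaw hmean hθ hacc).hasFisherInfo hθ
  rw [(hlaw θ hθ).map_eq, variance_score_gaussianPDFReal hvar hmean hacc] at hinfo
  convert hinfo using 1
  push_cast
  field_simp

end PropagatorFamily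

/-- `S` is the price, `f v η` the impact function at the fixed trading rate `v`, `G` the decay
kernel; the derivative of `f v` at `θ` is taken relative to the parameter set `Γ`. -/
theorem corollary2 {Ω : Type*} [MeasurableSpace Ω]
    (Γ : Set ℝ) (P : ℝ → Measure Ω) (S : ℝ → Ω → ℝ)
    (f : ℝ → ℝ → ℝ) (G : ℝ → ℝ) (S₀ σ v T t θ : ℝ)
    (hσ : 0 < σ) (ht : 0 < t) (htT : t < T)
    (hG : IntervalIntegrable G volume 0 T)
    (hS : ∀ η ∈ Γ, IsPropagatorPrice (P η) S₀ (f v η) σ T G S)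
    (hθ : θ ∈ Γ) (hacc : AccPt θ (Filter.principal Γ))
    (hf : DifferentiableWithinAt ℝ (f v) Γ θ) :
    HasFisherInfo Γ P (twoPrices S t T) θ (fisherInfo Γ P (twoPrices S t T) θ) ∧
    HasFisherInfo Γ P (vwapCost S T) θ (fisherInfo Γ P (vwapCost S T) θ) ∧
    fisherInfo Γ P (twoPrices S t T) θ =
      derivWithin (f v) Γ θ ^ 2 / σ ^ 2 * twoPriceFactor G t T ∧
    (twoPriceFactor G t T ≥ 3 / T ^ 3 * (∫ s in (0 : ℝ)..T, G s * (T - s)) ^ 2 →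
      fisherInfo Γ P (twoPrices S t T) θ ≥ fisherInfo Γ P (vwapCost S T) θ) ∧
    (derivWithin (f v) Γ θ ≠ 0 →
      (fisherInfo Γ P (twoPrices S t T) θ ≥ fisherInfo Γ P (vwapCost S T) θ ↔
        twoPriceFactor G t T ≥ 3 / T ^ 3 * (∫ s in (0 : ℝ)..T, G s * (T - s)) ^ 2)) := by
  have hT : 0 < T := ht.trans htT
  lift t to ℝ≥0 using ht.le
  lift T to ℝ≥0 using hT.le
  have hpair := hasFisherInfo_twoPrices hσ.ne' (by exact_mod_cast ht) (by exact_mod_cast htT) hG hS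
    hθ hacc hf.hasDerivWithinAt
  have hcost := hasFisherInfo_vwapCost hσ.ne' (by exact_mod_cast hT) hG hS hθ hacc
    hf.hasDerivWithinAt
  rw [hpair.fisherInfo_eq hθ hacc, hcost.fisherInfo_eq hθ hacc]
  exact ⟨hpair, hcost, rfl, fun hfactor => mul_le_mul_of_nonneg_left hfactor (by positivity),
    fun hd => mul_le_mul_iff_right₀ (by positivity)⟩
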